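/- Let $K$ be a field, $X$ an infinite set, and $\Lambda=K\langle X\rangle$ the free (unital associative) $K$-algebra on $X$. Let $\mathbb{L}=\mathbb{L}(X)$ be the corresponding Leavitt algebra, i.e. the unital associative $K$-algebra generated by $\{x,x^*\mid x\in X\}$ subject to the relations $y^*x=1$ if $x=y$ and $y^*x=0$ if $x\neq y$ $(x,y\in X)$; elements of $\Lambda$ are regarded as elements of $\mathbb{L}$ through the canonical homomorphism $\Lambda\to\mathbb{L}$, $x\mapsto x$. A polynomial in $\Lambda$ is called comonic if its constant term is $1$. Every $\gamma\in\Lambda$ is written uniquely as $\gamma=k_\gamma+\sum_{x\in X}x\gamma_x$ with $k_\gamma\in K$ and $\gamma_x\in\Lambda$, almost all $\gamma_x$ being $0$. (1) For any two polynomials $\delta,\gamma\in\Lambda$, not both zero, there is a comonic polynomial $\lambda\in\Lambda$ with $\mathbb{L}\delta+\mathbb{L}\gamma=\mathbb{L}\lambda$. (2) Let $\lambda\in\Lambda$ be comonic. Then $\Lambda/\Lambda\lambda$ carries a left $\mathbb{L}$-module structure in which elements of $\Lambda$ act by left multiplication and $x^*(\gamma+\Lambda\lambda)=(\gamma_x-k_\gamma\lambda_x)+\Lambda\lambda$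 for all $x\in X$, $\gamma\in\Lambda$, and the rule $\gamma+\Lambda\lambda\mapsto\gamma+\mathbb{L}\lambda$ defines an isomorphism $\Lambda/\Lambda\lambda\cong\mathbb{L}/\mathbb{L}\lambda$ of $\mathbb{L}$-modules. Moreover every $\mathbb{L}$-submodule of $\mathbb{L}/\mathbb{L}\lambda$ is cyclic, generated by the class $\gamma+\mathbb{L}\lambda$ of some comonic polynomial $\gamma\in\Lambda$. -/

import Mathlib

open scoped Classical in
/-- The right cofactor `f_x` of a polynomial `f` with respect to the variable `x`, where
`f = k + ∑ x, x * f_x` with `k` constant. On the basis of monomials it is the linear map which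
deletes the first letter of a monomial starting with `x` and kills every other monomial. -/
noncomputable def cofactor (K : Type*) [Field K] {X : Type*} (x : X) :
    FreeAlgebra K X →ₗ[K] FreeAlgebra K X :=
  (FreeAlgebra.basisFreeMonoid K X).constr K fun b : FreeMonoid X =>
    match FreeMonoid.toList b with
    | [] => 0
    | y :: t => if y = x then FreeAlgebra.basisFreeMonoid K X (FreeMonoid.ofList t) else 0

/-- The constant term of a polynomial in noncommuting variables. -/
noncomputable def constTerm {K : Type*} [Field K] {X : Type*} (f : FreeAlgebra K X) : K :=
  FreeAlgebra.algebraMapInv f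

/-- A polynomial is comonic if its constant term is `1`. -/
def IsComonic {K : Type*} [Field K] {X : Type*} (f : FreeAlgebra K X) : Prop :=
  constTerm f = 1

/-- The action `x ⋆_l f = f_x - k_f k_l⁻¹ l_x` of a variable `x` on the polynomials `f`, defined
by a polynomial `l` with nonzero constant term; `k_f`, `k_l` are the constant terms. -/
noncomputable def starAct {K : Type*} [Field K] {X : Type*} (l : FreeAlgebra K X) (x : X)
    (f : FreeAlgebra K X) : FreeAlgebra K X :=
  cofactor K x f - (constTerm f * (constTerm l)⁻¹) • cofactor K x l

open scoped Classical in
/-- The defining relations `y* x = δ_{x,y}` of the Leavitt algebra on an infinite set `X`; the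
generator `x` is `Sum.inl x` and the generator `x*` is `Sum.inr x`. -/
inductive LeavittRel (K : Type*) [Field K] (X : Type*) :
    FreeAlgebra K (X ⊕ X) → FreeAlgebra K (X ⊕ X) → Prop
  | mul (x y : X) : LeavittRel K X
      (FreeAlgebra.ι K (Sum.inr y) * FreeAlgebra.ι K (Sum.inl x)) (if x = y then 1 else 0)

/-- The Leavitt algebra of an infinite set `X` over `K`: the unital associative `K`-algebra
generated by `x, x*` for `x ∈ X`, subject to `y* x = 1` if `x = y` and `y* x = 0` if `x ≠ y`.
(For infinite `X` there is no relation on the elements `x x*`.) -/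
abbrev LeavittAlgebra (K : Type*) [Field K] (X : Type*) : Type _ :=
  RingQuot (LeavittRel K X)

namespace LeavittAlgebra

/-- The generator `x` of the Leavitt algebra. -/
noncomputable def var (K : Type*) [Field K] {X : Type*} (x : X) : LeavittAlgebra K X :=
  RingQuot.mkAlgHom K (LeavittRel K X) (FreeAlgebra.ι K (Sum.inl x))

/-- The generator `x*` of the Leavitt algebra. -/
noncomputable def starVar (K : Type*) [Field K] {X : Type*} (x : X) : LeavittAlgebra K X :=
  RingQuot.mkAlgHom K (LeavittRel K X) (FreeAlgebra.ι K (Sum.inr x))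

/-- The canonical homomorphism `x ↦ x` from the free algebra to the Leavitt algebra, through which
polynomials are regarded as elements of the Leavitt algebra. -/
noncomputable def ofPoly (K : Type*) [Field K] (X : Type*) :
    FreeAlgebra K X →ₐ[K] LeavittAlgebra K X :=
  FreeAlgebra.lift K (var K)

end LeavittAlgebra

/-- The principal left ideal `R a`, as a submodule of the left `R`-module `R`. -/
abbrev leftIdeal {R : Type*} [Ring R] (a : R) : Submodule R R :=
  Submodule.span R {a}

/-! In `𝕃` one has `x* f = f_x + k_f x*`, so a left ideal containing a polynomial without constant
term contains its cofactors, which have lower degree. Division with remainder follows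
(`exists_isComonic_generator`): a nonzero polynomial of least degree in a left ideal `I` has nonzero
constant term, and once scaled to `l` it generates every polynomial of `I`. This gives (1), since
`δ` and `γ` are polynomials. For (2), `x* l = l_x + x*` makes `x*` act on polynomials modulo `𝕃 l`
by `starAct`; hence every class is polynomial, and the map from `Λ ⧸ Λ l` is onto. It is injective
because `𝕃` already acts on `Λ ⧸ Λ l`. Submodules are handled by applying division to their
preimages in `𝕃`. -/

open LeavittAlgebra

/-! ### Cofactors, constant terms and degree in the free algebra -/

section FreeAlgebra

variable {K : Type*} [Field K] {X : Type*}

theorem FreeAlgebra.basisFreeMonoid_apply (b : FreeMonoid X) :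
    FreeAlgebra.basisFreeMonoid K X b = FreeMonoid.lift (FreeAlgebra.ι K) b := by
  simp [FreeAlgebra.basisFreeMonoid, FreeAlgebra.equivMonoidAlgebraFreeMonoid]

/-- Cofactors read the first letter of a word, so words are built by prepending one letter at a
time. -/
theorem FreeAlgebra.induction_left {P : FreeAlgebra K X → Prop} (one : P 1)
    (ι_mul : ∀ x f, P f → P (FreeAlgebra.ι K x * f)) (add : ∀ f g, P f → P g → P (f + g))
    (smul : ∀ (k : K) f, P f → P (k • f)) (f : FreeAlgebra K X) : P f := by
  have mono : ∀ b : FreeMonoid X, P (FreeAlgebra.basisFreeMonoid K X b) := by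
    intro b
    induction b using FreeMonoid.inductionOn' with
    | one => simpa [FreeAlgebra.basisFreeMonoid_apply] using one
    | of_mul x b ih =>
      have h := ι_mul x _ ih
      simpa [FreeAlgebra.basisFreeMonoid_apply] using h
  have hf := (FreeAlgebra.basisFreeMonoid K X).mem_span f
  induction hf using Submodule.span_induction with
  | mem y hy => obtain ⟨b, rfl⟩ := hy; exact mono b
  | zero => simpa using smul 0 1 one
  | add f g _ _ hf hg => exact add f g hf hg
  | smul k f _ hf => exact smul k f hf

@[simp] theorem cofactor_one (x : X) : cofactor K x 1 = 0 := by
  have h : FreeAlgebra.basisFreeMonoid K X 1 = 1 := by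
    simp [FreeAlgebra.basisFreeMonoid_apply]
  rw [← h, cofactor, Module.Basis.constr_basis]
  rfl

open scoped Classical in
@[simp] theorem cofactor_ι_mul (x y : X) (f : FreeAlgebra K X) :
    cofactor K x (FreeAlgebra.ι K y * f) = if y = x then f else 0 := by
  have key : cofactor K x ∘ₗ LinearMap.mulLeft K (FreeAlgebra.ι K y) =
      if y = x then LinearMap.id else 0 := by
    refine (FreeAlgebra.basisFreeMonoid K X).ext fun b => ?_
    have h : FreeAlgebra.ι K y * FreeAlgebra.basisFreeMonoid K X b =
        FreeAlgebra.basisFreeMonoid K X (FreeMonoid.of y * b) := by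
      simp [FreeAlgebra.basisFreeMonoid_apply]
    rw [LinearMap.comp_apply, LinearMap.mulLeft_apply, h, cofactor, Module.Basis.constr_basis]
    simp only [FreeMonoid.toList_of_mul]
    split_ifs <;> simp
  have h := LinearMap.congr_fun key f
  rw [LinearMap.comp_apply, LinearMap.mulLeft_apply] at h
  rw [h]
  split_ifs <;> simp

@[simp] theorem constTerm_one : constTerm (1 : FreeAlgebra K X) = 1 := map_one _
@[simp] theorem constTerm_mul (f g : FreeAlgebra K X) :
    constTerm (f * g) = constTerm f * constTerm g := map_mul _ _ _
@[simp] theorem constTerm_add (f g : FreeAlgebra K X) :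
    constTerm (f + g) = constTerm f + constTerm g := map_add _ _ _
@[simp] theorem constTerm_sub (f g : FreeAlgebra K X) :
    constTerm (f - g) = constTerm f - constTerm g := map_sub _ _ _
@[simp] theorem constTerm_smul (k : K) (f : FreeAlgebra K X) :
    constTerm (k • f) = k * constTerm f := map_smul FreeAlgebra.algebraMapInv k f
@[simp] theorem constTerm_ι (x : X) : constTerm (FreeAlgebra.ι K x) = 0 := by
  simp [constTerm, FreeAlgebra.algebraMapInv]

theorem cofactor_mul (x : X) (f g : FreeAlgebra K X) :
    cofactor K x (f * g) = constTerm f • cofactor K x g + cofactor K x f * g := by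
  classical
  induction f using FreeAlgebra.induction_left with
  | one => simp
  | ι_mul y f _ => rw [mul_assoc]; simp
  | add f₁ f₂ h₁ h₂ => simp only [add_mul, map_add, constTerm_add, h₁, h₂, add_smul]; abel
  | smul k f h => simp [h, smul_smul]

/-- The polynomials all of whose `n`-fold iterated cofactors vanish, i.e. those of degree less
than `n`. -/
noncomputable def degreeLT (K : Type*) [Field K] (X : Type*) : ℕ → Submodule K (FreeAlgebra K X)
  | 0 => ⊥
  | n + 1 => ⨅ x, (degreeLT K X n).comap (cofactor K x)

theorem mem_degreeLT_succ {n : ℕ} {f : FreeAlgebra K X} :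
    f ∈ degreeLT K X (n + 1) ↔ ∀ x, cofactor K x f ∈ degreeLT K X n := by
  simp [degreeLT]

theorem degreeLT_mono : Monotone (degreeLT K X) := by
  refine monotone_nat_of_le_succ fun n => ?_
  induction n with
  | zero => exact bot_le
  | succ n ih => exact fun f hf => mem_degreeLT_succ.2 fun x => ih (mem_degreeLT_succ.1 hf x)

theorem exists_mem_degreeLT (f : FreeAlgebra K X) : ∃ n, f ∈ degreeLT K X n := by
  classical
  induction f using FreeAlgebra.induction_left with
  | one => exact ⟨1, mem_degreeLT_succ.2 fun x => by simp⟩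
  | ι_mul y f h =>
    obtain ⟨n, hn⟩ := h
    refine ⟨n + 1, mem_degreeLT_succ.2 fun x => ?_⟩
    rw [cofactor_ι_mul]
    split_ifs
    exacts [hn, zero_mem _]
  | add f g hf hg =>
    obtain ⟨m, hm⟩ := hf
    obtain ⟨n, hn⟩ := hg
    exact ⟨max m n, add_mem (degreeLT_mono (le_max_left m n) hm)
      (degreeLT_mono (le_max_right m n) hn)⟩
  | smul k f h => exact h.imp fun n hn => Submodule.smul_mem _ k hn

/-- Without constant term, `f` is the finite sum of the `x * f_x`. Taking `φ` the identity and `I =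
⊥` yields a vanishing criterion; `φ = ofPoly K X` serves in the division argument. -/
theorem mem_of_cofactor_mem {A : Type*} [Ring A] [Algebra K A] (φ : FreeAlgebra K X →ₐ[K] A)
    (I : Submodule A A) {f : FreeAlgebra K X} (hf : constTerm f = 0)
    (h : ∀ x, φ (cofactor K x f) ∈ I) : φ f ∈ I := by
  classical
  obtain ⟨s, hs⟩ : ∃ s : Finset X, f = constTerm f • 1 +
      ∑ x ∈ s, FreeAlgebra.ι K x * cofactor K x f := by
    -- Allowing every larger `t` lets the supports of two summands be merged.
    have : ∃ s : Finset X, ∀ t, s ⊆ t → f = constTerm f • 1 +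
        ∑ x ∈ t, FreeAlgebra.ι K x * cofactor K x f := by
      clear h hf
      induction f using FreeAlgebra.induction_left with
      | one => exact ⟨∅, fun t _ => by simp⟩
      | ι_mul y f _ =>
        refine ⟨{y}, fun t ht => ?_⟩
        have hy : y ∈ t := ht (Finset.mem_singleton_self y)
        simp [hy]
      | add f g hf hg =>
        obtain ⟨s, hs⟩ := hf
        obtain ⟨t, ht⟩ := hg
        refine ⟨s ∪ t, fun u hu => ?_⟩
        conv_lhs => rw [hs u (Finset.union_subset_left hu), ht u (Finset.union_subset_right hu)]
        simp only [map_add, constTerm_add, mul_add, Finset.sum_add_distrib, add_smul]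
        abel
      | smul k f h =>
        obtain ⟨s, hs⟩ := h
        refine ⟨s, fun t ht => ?_⟩
        conv_lhs => rw [hs t ht]
        simp [smul_smul, Finset.smul_sum]
    exact this.imp fun s hs => hs s subset_rfl
  rw [hs, hf, zero_smul, zero_add, map_sum]
  exact sum_mem fun x _ => by rw [map_mul]; exact I.smul_mem _ (h x)

theorem eq_zero_of_cofactor_eq_zero {f : FreeAlgebra K X} (hf : constTerm f = 0)
    (h : ∀ x, cofactor K x f = 0) : f = 0 := by
  have := mem_of_cofactor_mem (AlgHom.id K (FreeAlgebra K X)) ⊥ hf (by simpa using h)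
  simpa using this

theorem IsComonic.ne_zero {l : FreeAlgebra K X} (hl : IsComonic l) : l ≠ 0 := by
  rintro rfl
  exact zero_ne_one ((map_zero FreeAlgebra.algebraMapInv).symm.trans hl)

/-- Comonicity cancels the term `k_f l_x` of the product rule, so `Λ l` is stable under `starAct l
x`. -/
theorem starAct_mul_self {l : FreeAlgebra K X} (hl : IsComonic l) (x : X)
    (f : FreeAlgebra K X) : starAct l x (f * l) = cofactor K x f * l := by
  rw [IsComonic] at hl
  simp [starAct, cofactor_mul, hl]

open scoped Classical in
theorem starAct_ι_mul (l : FreeAlgebra K X) (x y : X) (f : FreeAlgebra K X) :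
    starAct l x (FreeAlgebra.ι K y * f) = if y = x then f else 0 := by
  simp [starAct]

/-- `starAct` as a linear map. -/
noncomputable def starActₗ (l : FreeAlgebra K X) (x : X) :
    FreeAlgebra K X →ₗ[K] FreeAlgebra K X where
  toFun := starAct l x
  map_add' f g := by simp only [starAct, map_add, constTerm_add, add_mul, add_smul]; abel
  map_smul' k f := by simp [starAct, smul_sub, smul_smul, mul_assoc]

end FreeAlgebra

/-! ### Division by a comonic polynomial in the Leavitt algebra -/

namespace LeavittAlgebra

variable {K : Type*} [Field K] {X : Type*}

@[simp] theorem ofPoly_ι (x : X) : ofPoly K X (FreeAlgebra.ι K x) = var K x := by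
  simp [ofPoly]

open scoped Classical in
theorem starVar_mul_var (x y : X) :
    starVar K y * var K x = if x = y then 1 else 0 := by
  rw [starVar, var, ← map_mul, RingQuot.mkAlgHom_rel K (LeavittRel.mul x y)]
  split_ifs <;> simp

theorem starVar_mul_ofPoly (x : X) (f : FreeAlgebra K X) :
    starVar K x * ofPoly K X f = ofPoly K X (cofactor K x f) + constTerm f • starVar K x := by
  classical
  induction f using FreeAlgebra.induction_left with
  | one => simp
  | ι_mul y f _ =>
    rw [map_mul, ofPoly_ι, ← mul_assoc, starVar_mul_var, cofactor_ι_mul]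
    split_ifs <;> simp
  | add f g hf hg => simp only [map_add, mul_add, hf, hg, constTerm_add, add_smul]; abel
  | smul k f h => simp [h, smul_smul]

theorem induction_on {P : LeavittAlgebra K X → Prop}
    (algebraMap : ∀ k, P (algebraMap K (LeavittAlgebra K X) k)) (var : ∀ x, P (var K x))
    (starVar : ∀ x, P (starVar K x)) (mul : ∀ a b, P a → P b → P (a * b))
    (add : ∀ a b, P a → P b → P (a + b)) (a : LeavittAlgebra K X) : P a := by
  obtain ⟨f, rfl⟩ := RingQuot.mkAlgHom_surjective K (LeavittRel K X) a
  induction f using FreeAlgebra.induction with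
  | grade0 k => simpa using algebraMap k
  | grade1 x => rcases x with x | x; exacts [var x, starVar x]
  | mul f g hf hg => rw [map_mul]; exact mul _ _ hf hg
  | add f g hf hg => rw [map_add]; exact add _ _ hf hg

theorem ofPoly_cofactor_mem {I : Submodule (LeavittAlgebra K X) (LeavittAlgebra K X)}
    {f : FreeAlgebra K X} (hf : constTerm f = 0) (h : ofPoly K X f ∈ I) (x : X) :
    ofPoly K X (cofactor K x f) ∈ I := by
  have := I.smul_mem (starVar K x) h
  simpa [starVar_mul_ofPoly, hf] using this

theorem exists_isComonic_generator (I : Submodule (LeavittAlgebra K X) (LeavittAlgebra K X))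
    {f : FreeAlgebra K X} (hf : f ≠ 0) (hfI : ofPoly K X f ∈ I) :
    ∃ l, IsComonic l ∧ ofPoly K X l ∈ I ∧
      ∀ g, ofPoly K X g ∈ I → ofPoly K X g ∈ leftIdeal (ofPoly K X l) := by
  classical
  have hex : ∃ n, ∃ g ∈ degreeLT K X n, g ≠ 0 ∧ ofPoly K X g ∈ I :=
    (exists_mem_degreeLT f).imp fun n hn => ⟨f, hn, hf, hfI⟩
  obtain ⟨g, hg, hg0, hgI⟩ := Nat.find_spec hex
  have hmin : ∀ {m}, m < Nat.find hex → ∀ g ∈ degreeLT K X m, ofPoly K X g ∈ I → g = 0 :=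
    fun hm g hg hgI => by_contra fun h => Nat.find_min hex hm ⟨g, hg, h, hgI⟩
  -- Here `e` is the least degree of a nonzero polynomial in `I`.
  obtain ⟨e, he⟩ : ∃ e, Nat.find hex = e + 1 := by
    refine Nat.exists_eq_succ_of_ne_zero fun h0 => hg0 ?_
    rw [h0] at hg
    exact (Submodule.mem_bot K).1 hg
  rw [he] at hg hmin
  -- Otherwise all cofactors of `g` lie in `I` in lower degree, hence vanish, and so does `g`.
  have hk : constTerm g ≠ 0 := fun hk => hg0 <| eq_zero_of_cofactor_eq_zero hk fun x =>
    hmin e.lt_succ_self _ (mem_degreeLT_succ.1 hg x) (ofPoly_cofactor_mem hk hgI x)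
  have hlI : ofPoly K X ((constTerm g)⁻¹ • g) ∈ I := by
    rw [map_smul, Algebra.smul_def]
    exact I.smul_mem _ hgI
  have hl : (constTerm g)⁻¹ • g ∈ degreeLT K X (e + 1) := Submodule.smul_mem _ _ hg
  have hlc : IsComonic ((constTerm g)⁻¹ • g) := by simp [IsComonic, hk]
  generalize (constTerm g)⁻¹ • g = l at hl hlI hlc
  refine ⟨l, hlc, hlI, fun p hp => ?_⟩
  obtain ⟨n, hn⟩ := exists_mem_degreeLT p
  induction n generalizing p with
  | zero => rw [(Submodule.mem_bot K).1 hn, map_zero]; exact zero_mem _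
  | succ n ih =>
    -- Below degree `e` minimality forces `p = 0`. Otherwise subtracting `constTerm p • l` does not
    -- raise the degree bound and kills the constant term, so induction applies to the cofactors.
    rcases Nat.lt_or_ge n e with hne | hne
    · rw [hmin (Nat.succ_lt_succ hne) p hn hp, map_zero]; exact zero_mem _
    have hsub : ∀ J : Submodule (LeavittAlgebra K X) (LeavittAlgebra K X),
        ofPoly K X l ∈ J → ofPoly K X (constTerm p • l) ∈ J := fun J hJ => by
      rw [map_smul, Algebra.smul_def]
      exact J.smul_mem _ hJ
    have hc : constTerm (p - constTerm p • l) = 0 := by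
      rw [IsComonic] at hlc
      simp [hlc]
    have hqI : ofPoly K X (p - constTerm p • l) ∈ I := by
      rw [map_sub]
      exact sub_mem hp (hsub I hlI)
    have hq : p - constTerm p • l ∈ degreeLT K X (n + 1) :=
      sub_mem hn (Submodule.smul_mem _ _ (degreeLT_mono (Nat.succ_le_succ hne) hl))
    have := mem_of_cofactor_mem (ofPoly K X) (leftIdeal (ofPoly K X l)) hc fun x =>
      ih _ (ofPoly_cofactor_mem hc hqI x) (mem_degreeLT_succ.1 hq x)
    rw [map_sub] at this
    exact (Submodule.sub_mem_iff_left _ (hsub _ (Submodule.mem_span_singleton_self _))).1 this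

/-- The difference is exactly `k_f x* l`, because `x* l = l_x + x*`. -/
theorem starVar_mul_ofPoly_sub_mem {l : FreeAlgebra K X} (hl : IsComonic l) (x : X)
    (f : FreeAlgebra K X) :
    starVar K x * ofPoly K X f - ofPoly K X (starAct l x f) ∈ leftIdeal (ofPoly K X l) := by
  have h : starVar K x * ofPoly K X f - ofPoly K X (starAct l x f) =
      (constTerm f • starVar K x) * ofPoly K X l := by
    rw [IsComonic] at hl
    simp [starVar_mul_ofPoly, starAct, hl, smul_add]
    abel
  rw [h]
  exact Submodule.smul_mem _ _ (Submodule.mem_span_singleton_self _)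

theorem exists_ofPoly_sub_mem {l : FreeAlgebra K X} (hl : IsComonic l) (a : LeavittAlgebra K X) :
    ∃ f, a - ofPoly K X f ∈ leftIdeal (ofPoly K X l) := by
  -- The statement for `a * g` with `g` arbitrary passes to products of Leavitt elements.
  suffices h : ∀ g, ∃ f, a * ofPoly K X g - ofPoly K X f ∈ leftIdeal (ofPoly K X l) by
    simpa using h 1
  induction a using induction_on with
  | algebraMap k => exact fun g => ⟨k • g, by simp [Algebra.smul_def]⟩
  | var x => exact fun g => ⟨FreeAlgebra.ι K x * g, by simp⟩
  | starVar x => exact fun g => ⟨_, starVar_mul_ofPoly_sub_mem hl x g⟩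
  | mul a b ha hb =>
    intro g
    obtain ⟨f, hf⟩ := hb g
    obtain ⟨h, hh⟩ := ha f
    refine ⟨h, ?_⟩
    have := add_mem (Submodule.smul_mem _ a hf) hh
    simpa [mul_sub, mul_assoc] using this
  | add a b ha hb =>
    intro g
    obtain ⟨f, hf⟩ := ha g
    obtain ⟨h, hh⟩ := hb g
    refine ⟨f + h, ?_⟩
    have := add_mem hf hh
    rwa [← add_sub_add_comm, ← add_mul, ← map_add] at this

/-! ### The module `Λ ⧸ Λ l` and its comparison with `𝕃 ⧸ 𝕃 l` -/

/-- The operator on `Λ ⧸ Λ l` induced by `starAct l x`. -/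
noncomputable def starEnd {l : FreeAlgebra K X} (hl : IsComonic l) (x : X) :
    Module.End K (FreeAlgebra K X ⧸ leftIdeal l) :=
  -- `starAct l x` is `K`-linear but not `Λ`-linear in general, so it descends to the quotient over
  -- `K`.
  (Submodule.Quotient.restrictScalarsEquiv K (leftIdeal l)).conj <|
    Submodule.mapQ _ _ (starActₗ l x) <| by
      intro f hf
      obtain ⟨g, rfl⟩ := Submodule.mem_span_singleton.1 ((Submodule.restrictScalars_mem K _ f).1 hf)
      exact Submodule.mem_span_singleton.2 ⟨cofactor K x g, (starAct_mul_self hl x g).symm⟩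

theorem starEnd_mkQ {l : FreeAlgebra K X} (hl : IsComonic l) (x : X) (f : FreeAlgebra K X) :
    starEnd hl x ((leftIdeal l).mkQ f) = (leftIdeal l).mkQ (starAct l x f) := rfl

/-- The representation of the Leavitt algebra on `Λ ⧸ Λ l`. -/
noncomputable def quotientRep {l : FreeAlgebra K X} (hl : IsComonic l) :
    LeavittAlgebra K X →ₐ[K] Module.End K (FreeAlgebra K X ⧸ leftIdeal l) :=
  RingQuot.liftAlgHom K ⟨FreeAlgebra.lift K
    (Sum.elim (fun x => Algebra.lsmul K K _ (FreeAlgebra.ι K x)) (starEnd hl)), by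
      classical
      rintro _ _ ⟨x, y⟩
      refine LinearMap.ext fun q => ?_
      obtain ⟨f, rfl⟩ := (leftIdeal l).mkQ_surjective q
      have h : starEnd hl y (FreeAlgebra.ι K x • (leftIdeal l).mkQ f) =
          (leftIdeal l).mkQ (if x = y then f else 0) := by
        rw [← map_smul, starEnd_mkQ, smul_eq_mul, starAct_ι_mul]
      rw [map_mul, FreeAlgebra.lift_ι_apply, FreeAlgebra.lift_ι_apply]
      refine h.trans ?_
      split_ifs <;> simp⟩

theorem quotientRep_var {l : FreeAlgebra K X} (hl : IsComonic l) (x : X) :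
    quotientRep hl (var K x) = Algebra.lsmul K K _ (FreeAlgebra.ι K x) := by
  simp [quotientRep, var]

theorem quotientRep_starVar {l : FreeAlgebra K X} (hl : IsComonic l) (x : X) :
    quotientRep hl (starVar K x) = starEnd hl x := by
  simp [quotientRep, starVar]

theorem quotientRep_ofPoly {l : FreeAlgebra K X} (hl : IsComonic l) (g : FreeAlgebra K X) :
    quotientRep hl (ofPoly K X g) = Algebra.lsmul K K _ g := by
  suffices h : (quotientRep hl).comp (ofPoly K X) = Algebra.lsmul K K _ from
    DFunLike.congr_fun h g
  ext x : 2
  simp [quotientRep_var]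

theorem quotientRep_ofPoly_mkQ {l : FreeAlgebra K X} (hl : IsComonic l)
    (g f : FreeAlgebra K X) :
    quotientRep hl (ofPoly K X g) ((leftIdeal l).mkQ f) = (leftIdeal l).mkQ (g * f) := by
  rw [quotientRep_ofPoly]
  rfl

/-- The additive map `Λ ⧸ Λ l → 𝕃 ⧸ 𝕃 l` induced by `ofPoly`. -/
noncomputable def quotientMap (l : FreeAlgebra K X) :
    FreeAlgebra K X ⧸ leftIdeal l →+ LeavittAlgebra K X ⧸ leftIdeal (ofPoly K X l) :=
  QuotientAddGroup.map (leftIdeal l).toAddSubgroup (leftIdeal (ofPoly K X l)).toAddSubgroup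
    (ofPoly K X).toRingHom.toAddMonoidHom <| by
      intro f hf
      obtain ⟨g, rfl⟩ := Submodule.mem_span_singleton.1 hf
      exact Submodule.mem_span_singleton.2 ⟨ofPoly K X g, (map_mul (ofPoly K X) g l).symm⟩

theorem quotientMap_mkQ (l f : FreeAlgebra K X) :
    quotientMap l ((leftIdeal l).mkQ f) = (leftIdeal (ofPoly K X l)).mkQ (ofPoly K X f) := rfl

theorem quotientMap_quotientRep_ofPoly {l : FreeAlgebra K X} (hl : IsComonic l)
    (g : FreeAlgebra K X) (q : FreeAlgebra K X ⧸ leftIdeal l) :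
    quotientMap l (quotientRep hl (ofPoly K X g) q) = ofPoly K X g • quotientMap l q := by
  obtain ⟨f, rfl⟩ := (leftIdeal l).mkQ_surjective q
  rw [quotientRep_ofPoly_mkQ, quotientMap_mkQ, quotientMap_mkQ, map_mul]
  rfl

theorem quotientMap_quotientRep {l : FreeAlgebra K X} (hl : IsComonic l)
    (a : LeavittAlgebra K X) (q : FreeAlgebra K X ⧸ leftIdeal l) :
    quotientMap l (quotientRep hl a q) = a • quotientMap l q := by
  induction a using induction_on generalizing q with
  | algebraMap k =>
    rw [← (ofPoly K X).commutes k]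
    exact quotientMap_quotientRep_ofPoly hl _ q
  | var x =>
    rw [← ofPoly_ι x]
    exact quotientMap_quotientRep_ofPoly hl _ q
  | starVar x =>
    obtain ⟨f, rfl⟩ := (leftIdeal l).mkQ_surjective q
    rw [quotientRep_starVar, starEnd_mkQ, quotientMap_mkQ, quotientMap_mkQ, ← map_smul, eq_comm]
    exact (Submodule.Quotient.eq _).2 (starVar_mul_ofPoly_sub_mem hl x f)
  | mul a b ha hb => rw [map_mul, Module.End.mul_apply, ha, hb, mul_smul]
  | add a b ha hb => rw [map_add, LinearMap.add_apply, map_add, ha, hb, add_smul]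

theorem quotientMap_surjective {l : FreeAlgebra K X} (hl : IsComonic l) :
    Function.Surjective (quotientMap l) := by
  intro q
  obtain ⟨a, rfl⟩ := (leftIdeal (ofPoly K X l)).mkQ_surjective q
  obtain ⟨f, hf⟩ := exists_ofPoly_sub_mem hl a
  exact ⟨(leftIdeal l).mkQ f, ((Submodule.Quotient.eq _).2 hf).symm⟩

/-- If `f = a l` in `𝕃`, acting on the class of `1` shows that the class of `f` is `a` applied to
the class of `l`, which is zero. -/
theorem quotientMap_injective {l : FreeAlgebra K X} (hl : IsComonic l) :
    Function.Injective (quotientMap l) := by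
  refine (injective_iff_map_eq_zero _).2 fun q hq => ?_
  obtain ⟨f, rfl⟩ := (leftIdeal l).mkQ_surjective q
  rw [quotientMap_mkQ] at hq
  obtain ⟨a, ha⟩ := Submodule.mem_span_singleton.1 ((Submodule.Quotient.mk_eq_zero _).1 hq)
  have key : ∀ g, quotientRep hl (ofPoly K X g) ((leftIdeal l).mkQ 1) = (leftIdeal l).mkQ g := by
    intro g
    rw [quotientRep_ofPoly_mkQ, mul_one]
  have hl0 : (leftIdeal l).mkQ l = 0 :=
    (Submodule.Quotient.mk_eq_zero _).2 (Submodule.mem_span_singleton_self l)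
  rw [← key f, ← ha, smul_eq_mul, map_mul, Module.End.mul_apply, key l, hl0, map_zero]

end LeavittAlgebra

/-! ### The theorem -/

theorem theorem5p1 (K : Type*) [Field K] (X : Type*) [Infinite X] :
    -- the sum of the left ideals generated by two polynomials, not both zero
    (∀ δ γ : FreeAlgebra K X, ¬ (δ = 0 ∧ γ = 0) →
      ∃ l : FreeAlgebra K X, IsComonic l ∧
        leftIdeal (LeavittAlgebra.ofPoly K X δ) ⊔ leftIdeal (LeavittAlgebra.ofPoly K X γ) =
          leftIdeal (LeavittAlgebra.ofPoly K X l)) ∧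
    ∀ l : FreeAlgebra K X, IsComonic l →
      -- the module structure on `Λ ⧸ Λ l` over the Leavitt algebra and the natural isomorphism
      (∃ _ : Module (LeavittAlgebra K X) (FreeAlgebra K X ⧸ leftIdeal l),
        (∀ g f : FreeAlgebra K X,
          LeavittAlgebra.ofPoly K X g • (leftIdeal l).mkQ f = (leftIdeal l).mkQ (g * f)) ∧
        (∀ (x : X) (f : FreeAlgebra K X),
          LeavittAlgebra.starVar K x • (leftIdeal l).mkQ f =
            (leftIdeal l).mkQ (starAct l x f)) ∧
        ∃ e : (FreeAlgebra K X ⧸ leftIdeal l) ≃ₗ[LeavittAlgebra K X]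
            (LeavittAlgebra K X ⧸ leftIdeal (LeavittAlgebra.ofPoly K X l)),
          ∀ f : FreeAlgebra K X,
            e ((leftIdeal l).mkQ f) =
              (leftIdeal (LeavittAlgebra.ofPoly K X l)).mkQ (LeavittAlgebra.ofPoly K X f)) ∧
      -- every submodule is generated by the class of a comonic polynomial
      ∀ N : Submodule (LeavittAlgebra K X)
          (LeavittAlgebra K X ⧸ leftIdeal (LeavittAlgebra.ofPoly K X l)),
        ∃ γ : FreeAlgebra K X, IsComonic γ ∧
          N = Submodule.span (LeavittAlgebra K X)
            {(leftIdeal (LeavittAlgebra.ofPoly K X l)).mkQ (LeavittAlgebra.ofPoly K X γ)} := by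
  refine ⟨fun δ γ h => ?_, fun l hl => ⟨?_, fun N => ?_⟩⟩
  · obtain ⟨f, hf, hfI⟩ : ∃ f : FreeAlgebra K X, f ≠ 0 ∧
        ofPoly K X f ∈ leftIdeal (ofPoly K X δ) ⊔ leftIdeal (ofPoly K X γ) := by
      by_cases hδ : δ = 0
      · exact ⟨γ, fun hγ => h ⟨hδ, hγ⟩,
          Submodule.mem_sup_right (Submodule.mem_span_singleton_self _)⟩
      · exact ⟨δ, hδ, Submodule.mem_sup_left (Submodule.mem_span_singleton_self _)⟩
    obtain ⟨l, hl, hlI, hmem⟩ := exists_isComonic_generator _ hf hfI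
    refine ⟨l, hl, le_antisymm (sup_le ?_ ?_) ?_⟩ <;>
      rw [Submodule.span_singleton_le_iff_mem]
    · exact hmem δ (Submodule.mem_sup_left (Submodule.mem_span_singleton_self _))
    · exact hmem γ (Submodule.mem_sup_right (Submodule.mem_span_singleton_self _))
    · exact hlI
  · let : Module (LeavittAlgebra K X) (FreeAlgebra K X ⧸ leftIdeal l) :=
      Module.compHom _ (quotientRep hl).toRingHom
    refine ⟨this, fun g f => ?_, fun x f => ?_, ?_⟩
    · exact quotientRep_ofPoly_mkQ hl g f
    · change quotientRep hl (starVar K x) _ = _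
      rw [quotientRep_starVar, starEnd_mkQ]
    · exact ⟨LinearEquiv.ofBijective
        { quotientMap l with map_smul' := quotientMap_quotientRep hl }
        ⟨quotientMap_injective hl, quotientMap_surjective hl⟩, quotientMap_mkQ l⟩
  -- The preimage of `N` in `𝕃` contains the nonzero polynomial `l`, even when `N` is zero.
  · obtain ⟨γ, hγ, hγI, hmem⟩ := exists_isComonic_generator
      (N.comap (leftIdeal (ofPoly K X l)).mkQ) hl.ne_zero (by
        have h0 : (leftIdeal (ofPoly K X l)).mkQ (ofPoly K X l) = 0 :=
          (Submodule.Quotient.mk_eq_zero _).2 (Submodule.mem_span_singleton_self _)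
        rw [Submodule.mem_comap, h0]
        exact zero_mem N)
    refine ⟨γ, hγ, le_antisymm (fun q hq => ?_) ?_⟩
    -- Every class has a polynomial representative, so control of the polynomials in the preimage
    -- suffices.
    · obtain ⟨p, rfl⟩ := quotientMap_surjective hl q
      obtain ⟨f, rfl⟩ := (leftIdeal l).mkQ_surjective p
      rw [quotientMap_mkQ] at hq ⊢
      have h := Submodule.mem_map_of_mem (f := (leftIdeal (ofPoly K X l)).mkQ) (hmem f hq)
      rwa [Submodule.map_span, Set.image_singleton] at h
    · exact (Submodule.span_singleton_le_iff_mem _ _).2 hγI
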